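/- Let $\mathcal{C}$ be an extriangulated category $(\mathcal C,\mathbb E,\mathfrak s)$ (in the sense of Nakaoka–Palu) with higher extension groups, that is, either $\mathcal C$ is abelian (with the short exact sequences as conflations) or triangulated (with $\mathbb E(X,Y)=\mathcal C(X,Y[1])$ and the distinguished triangles as $\mathbb E$-triangles), or $\mathcal C$ has enough $\mathbb E$-projectives and enough $\mathbb E$-injectives. For $k\ge 1$ let $\mathbb E^k(X,Y)$ be, respectively, $\mathrm{Ext}^k_{\mathcal C}(X,Y)$, $\mathcal C(X,Y[k])$, or $\mathbb E(\Omega^{k-1}X,Y)\cong\mathbb E(X,\Sigma^{k-1}Y)$, where $\Omega$ and $\Sigma$ denote syzygies and cosyzygies. Let $\mathcal X,\mathcal Y,\omega,\mathcal S,\mathcal A,\mathcal B$ denote classes of objects of $\mathcal C$. *Conventions.* A conflation $A\to B\to C$ is the sequence of an $\mathbb E$-triangle $A\to B\to C\dashrightarrow$. The class $\mathcal X$ is closed under extensions (resp. cocones, cones) if for every conflation $A\to B\to C$ one has: $A,C\in\mathcal X\Rightarrow B\in\mathcal X$ (resp. $B,C\in\mathcal X\Rightarrow A\in\mathcal X$;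 $A,B\in\mathcal X\Rightarrow C\in\mathcal X$). It is closed under direct summands if $N\in\mathcal X$ and $N\cong M\oplus M'$ imply $M\in\mathcal X$. It is left thick (resp. right thick) if it is closed under extensions, direct summands and cocones (resp. cones), and thick if it is both; $\mathsf{Thick}(\mathcal X)$ is the smallest thick class containing $\mathcal X$. An object $M$ has an $\mathcal X$-resolution of length $0$ if it is isomorphic to an object of $\mathcal X$, and one of length $n+1$ if there is an $\mathbb E$-triangle $Z\to X\to M\dashrightarrow$ with $X\in\mathcal X$ such that $Z$ has an $\mathcal X$-resolution of length $n$; $\mathcal X^\wedge$ is the class of objects having an $\mathcal X$-resolution of some finite length. Put $\mathrm{id}_{\mathcal X}(M)=\min\{m\ge 0:\mathbb E^{j}(X,M)=0\ \forall j\ge m+1,\ \forall X\in\mathcal X\}$ (with $\min\emptyset=\infty$), $\mathrm{id}_{\mathcal X}(\mathcal Y)=\sup_{Y\in\mathcal Y}\mathrm{id}_{\mathcal X}(Y)$ (which is $0$ if $\mathcal Y=\emptyset$), and dually $\mathrm{pd}_{\mathcal X}(\mathcal Y)$. A pair $(\mathcal X,\omega)$ is a *left Frobenius pair* if $\mathcal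 X$ is left thick, $\omega$ is closed under direct summands, $\mathrm{id}_{\mathcal X}(\omega)=0$, and $\omega$ is a relative cogenerator in $\mathcal X$: $\omega\subseteq\mathcal X$ and each $X\in\mathcal X$ admits an $\mathbb E$-triangle $X\to W\to X'\dashrightarrow$ with $W\in\omega$, $X'\in\mathcal X$. It is a *left Frobenius pair cut on $\mathcal S$* if (1) $\mathcal X$ is left thick; (2) $(\mathcal X\cap\mathcal S,\omega\cap\mathcal S)$ is a left Frobenius pair; (3) $\mathrm{pd}_{\omega}(\omega\cap\mathcal S)=0$ and $\omega\cap\mathcal S$ is a relative generator in $\omega$, i.e. each $V\in\omega$ admits an $\mathbb E$-triangle $V'\to W\to V\dashrightarrow$ with $W\in\omega\cap\mathcal S$, $V'\in\omega$; (4) $\omega$ is closed under extensions and direct summands. The pair $(\mathcal A,\mathcal B)$ is a *left weak AB context cut on $\mathcal S$* if $(\mathcal A,\mathcal A\cap\mathcal B)$ is a left Frobenius pair cut on $\mathcal S$, $\mathcal B\cap\mathcal S$ is right thick, and $\mathcal B\cap\mathcal S\subseteq(\mathcal A\cap\mathcal S)^\wedge$. The pair $(\mathcal A,\mathcal B)$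 is a *$1$-cotorsion pair cut on $\mathcal S$* if $\mathcal A$ and $\mathcal B$ are closed under direct summands, $\mathbb E^1(\mathcal A\cap\mathcal S,\mathcal B)=0=\mathbb E^1(\mathcal A,\mathcal B\cap\mathcal S)$, and each $M\in\mathcal S$ admits $\mathbb E$-triangles $K\to A\to M\dashrightarrow$ and $M\to B\to L\dashrightarrow$ with $A,L\in\mathcal A$ and $B,K\in\mathcal B$. **Proposition.** Let $(\mathcal A,\mathcal B)$ be a left weak AB context cut on $\mathcal S$, and set $\omega:=\mathcal A\cap\mathcal B$. Then: 1. $(\omega\cap\mathcal S)^\wedge=\mathcal B\cap\mathcal S$, $\ \mathrm{id}_{\mathcal A\cap\mathcal S}(\mathcal B\cap\mathcal S)=0$, and $\mathsf{Thick}(\mathcal A\cap\mathcal S)=(\mathcal A\cap\mathcal S)^\wedge$. 2. $(\mathcal A\cap\mathcal S,\mathcal B\cap\mathcal S)$ is a $1$-cotorsion pair cut on $\mathsf{Thick}(\mathcal A\cap\mathcal S)$ (with $\mathrm{id}_{\mathcal A\cap\mathcal S}(\mathcal B\cap\mathcal S)=0$). -/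

import Mathlib

open CategoryTheory CategoryTheory.Limits Opposite

universe w v u

namespace Extri

section Extensions

variable {C : Type u} [Category.{v} C] [Preadditive C]

/-- The `𝔼`-extensions `δ ∈ 𝔼(X, A)`. -/
abbrev Extension (E : Cᵒᵖ ⥤ C ⥤ AddCommGrpCat.{w}) (X A : C) : Type w :=
  (E.obj (op X)).obj A

/-- `aδ = 𝔼(X, a)(δ)`. -/
def push (E : Cᵒᵖ ⥤ C ⥤ AddCommGrpCat.{w}) {X A A' : C} (a : A ⟶ A')
    (δ : Extension E X A) : Extension E X A' :=
  ((E.obj (op X)).map a).hom δ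

/-- `δc = 𝔼(c, A)(δ)`. -/
def pull (E : Cᵒᵖ ⥤ C ⥤ AddCommGrpCat.{w}) {X X' A : C} (c : X' ⟶ X)
    (δ : Extension E X A) : Extension E X' A :=
  ((E.map c.op).app A).hom δ

/-- The element `δ ⊕ δ'` of `𝔼(X ⊕ X', A ⊕ A')` with components `(δ, 0, 0, δ')`. -/
noncomputable def directSum [HasBinaryBiproducts C] (E : Cᵒᵖ ⥤ C ⥤ AddCommGrpCat.{w})
    {X X' A A' : C} (δ : Extension E X A) (δ' : Extension E X' A') :
    Extension E (X ⊞ X') (A ⊞ A') :=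
  push E biprod.inl (pull E biprod.fst δ) + push E biprod.inr (pull E biprod.snd δ')

/-- A sequence `A ⟶ B ⟶ X` with prescribed ends. -/
structure Seq (A X : C) where
  mid : C
  fst : A ⟶ mid
  snd : mid ⟶ X

/-- Two sequences `A ⟶ B ⟶ X` and `A ⟶ B' ⟶ X` are equivalent if there is an isomorphism
`b : B ≅ B'` compatible with the maps. -/
def Seq.Equiv {A X : C} (S T : Seq A X) : Prop :=
  ∃ b : S.mid ≅ T.mid, S.fst ≫ b.hom = T.fst ∧ b.hom ≫ T.snd = S.snd

instance seqSetoid (A X : C) : Setoid (Seq A X) where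
  r := Seq.Equiv
  iseqv :=
    { refl := fun S => ⟨Iso.refl _, by simp, by simp⟩
      symm := by
        rintro S T ⟨b, h₁, h₂⟩
        exact ⟨b.symm, by simp [← h₁], by simp [← h₂]⟩
      trans := by
        rintro S T U ⟨b, h₁, h₂⟩ ⟨c, h₃, h₄⟩
        exact ⟨b ≪≫ c, by simp [← h₃, ← h₁], by simp [h₂, h₄]⟩ }

/-- Given a correspondence `s` from `𝔼`-extensions to equivalence classes of sequences,
`A ⟶ B ⟶ X` realizes `δ` if `s(δ) = [A ⟶ B ⟶ X]`. -/
def RealizesBy {E : Cᵒᵖ ⥤ C ⥤ AddCommGrpCat.{w}}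
    (s : ∀ {X A : C}, Extension E X A → Quotient (seqSetoid A X))
    {X A B : C} (δ : Extension E X A) (x : A ⟶ B) (y : B ⟶ X) : Prop :=
  s δ = Quotient.mk (seqSetoid A X) ⟨B, x, y⟩

end Extensions

/-- An extriangulated (externally triangulated) structure `(𝔼, 𝔰)`, in the sense of Nakaoka and
Palu, on an additive category `C`. -/
class Extriangulated (C : Type u) [Category.{v} C] [Preadditive C] [HasZeroObject C]
    [HasBinaryBiproducts C] where
  /-- the bifunctor `𝔼 : Cᵒᵖ × C ⥤ Ab` -/
  E : Cᵒᵖ ⥤ C ⥤ AddCommGrpCat.{w}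
  /-- (ET1): `𝔼` is additive in both variables -/
  additive_left : E.Additive
  additive_right : ∀ X : Cᵒᵖ, (E.obj X).Additive
  /-- the correspondence `𝔰` -/
  s : ∀ {X A : C}, Extension E X A → Quotient (seqSetoid A X)
  /-- (ET2): `𝔰` is a realization -/
  realization : ∀ {X A B X' A' B' : C} {δ : Extension E X A} {δ' : Extension E X' A'}
    {x : A ⟶ B} {y : B ⟶ X} {x' : A' ⟶ B'} {y' : B' ⟶ X'},
    RealizesBy s δ x y → RealizesBy s δ' x' y' →
    ∀ (a : A ⟶ A') (c : X ⟶ X'), push E a δ = pull E c δ' →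
      ∃ b : B ⟶ B', x ≫ b = a ≫ x' ∧ y ≫ c = b ≫ y'
  /-- (ET2): `𝔰` is additive -/
  realizes_zero : ∀ X A : C,
    RealizesBy s (0 : Extension E X A) (biprod.inl : A ⟶ A ⊞ X) (biprod.snd : A ⊞ X ⟶ X)
  realizes_directSum : ∀ {X A B X' A' B' : C} {δ : Extension E X A} {δ' : Extension E X' A'}
    {x : A ⟶ B} {y : B ⟶ X} {x' : A' ⟶ B'} {y' : B' ⟶ X'},
    RealizesBy s δ x y → RealizesBy s δ' x' y' →
    RealizesBy s (directSum E δ δ') (biprod.map x x') (biprod.map y y')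
  /-- (ET3) -/
  et3 : ∀ {X A B X' A' B' : C} {δ : Extension E X A} {δ' : Extension E X' A'}
    {x : A ⟶ B} {y : B ⟶ X} {x' : A' ⟶ B'} {y' : B' ⟶ X'},
    RealizesBy s δ x y → RealizesBy s δ' x' y' →
    ∀ (a : A ⟶ A') (b : B ⟶ B'), x ≫ b = a ≫ x' →
      ∃ c : X ⟶ X', y ≫ c = b ≫ y' ∧ push E a δ = pull E c δ'
  /-- (ET3)ᵒᵖ -/
  et3_op : ∀ {X A B X' A' B' : C} {δ : Extension E X A} {δ' : Extension E X' A'}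
    {x : A ⟶ B} {y : B ⟶ X} {x' : A' ⟶ B'} {y' : B' ⟶ X'},
    RealizesBy s δ x y → RealizesBy s δ' x' y' →
    ∀ (b : B ⟶ B') (c : X ⟶ X'), y ≫ c = b ≫ y' →
      ∃ a : A ⟶ A', x ≫ b = a ≫ x' ∧ push E a δ = pull E c δ'
  /-- (ET4) -/
  et4 : ∀ {A B D M F : C} {δ : Extension E D A} {δ' : Extension E F B}
    {f : A ⟶ B} {f' : B ⟶ D} {g : B ⟶ M} {g' : M ⟶ F},
    RealizesBy s δ f f' → RealizesBy s δ' g g' →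
    ∃ (N : C) (d : D ⟶ N) (e : N ⟶ F) (h : A ⟶ M) (h' : M ⟶ N) (δ'' : Extension E N A),
      h = f ≫ g ∧ f' ≫ d = g ≫ h' ∧ h' ≫ e = g' ∧
      RealizesBy s δ'' h h' ∧ RealizesBy s (push E f' δ') d e ∧
      pull E d δ'' = δ ∧ push E f δ'' = pull E e δ'
  /-- (ET4)ᵒᵖ -/
  et4_op : ∀ {D A B F M : C} {δ : Extension E B D} {δ' : Extension E M F}
    {f' : D ⟶ A} {f : A ⟶ B} {g' : F ⟶ B} {g : B ⟶ M},
    RealizesBy s δ f' f → RealizesBy s δ' g' g →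
    ∃ (N : C) (d : D ⟶ N) (e : N ⟶ F) (h : A ⟶ M) (h' : N ⟶ A) (δ'' : Extension E M N),
      h = f ≫ g ∧ d ≫ h' = f' ∧ h' ≫ f = e ≫ g' ∧
      RealizesBy s δ'' h' h ∧ RealizesBy s (pull E g' δ) d e ∧
      push E e δ'' = δ' ∧ push E d δ = pull E g δ''

section

variable {C : Type u} [Category.{v} C] [Preadditive C] [HasZeroObject C] [HasBinaryBiproducts C]
  [Extriangulated.{w} C]

/-- The group `𝔼(X, A)` of the extriangulated category `C`. -/
abbrev Ext1 (X A : C) : Type w := Extension (Extriangulated.E (C := C)) X A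

/-- `A ⟶ B ⟶ X` realizes `δ`; in other words `A ⟶ B ⟶ X ⇢` is an `𝔼`-triangle. -/
def Realizes {X A B : C} (δ : Ext1 X A) (x : A ⟶ B) (y : B ⟶ X) : Prop :=
  RealizesBy Extriangulated.s δ x y

/-- Conflations: the sequences underlying an `𝔼`-triangle. -/
def IsConflation {X A B : C} (x : A ⟶ B) (y : B ⟶ X) : Prop :=
  ∃ δ : Ext1 X A, Realizes δ x y

/-- There is an `𝔼`-triangle `A ⟶ B ⟶ X ⇢`. -/
def ExistsTriangle (A B X : C) : Prop :=
  ∃ (x : A ⟶ B) (y : B ⟶ X), IsConflation x y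

/-! ### Closure properties and thick subcategories -/

def ClosedUnderExtensions (P : ObjectProperty C) : Prop :=
  ∀ A B X : C, ExistsTriangle A B X → P A → P X → P B

/-- `M` is a direct summand of `N` if `N ≅ M ⊕ M'` for some `M'`. -/
def ClosedUnderDirectSummands (P : ObjectProperty C) : Prop :=
  ∀ M M' N : C, Nonempty (N ≅ M ⊞ M') → P N → P M

def ClosedUnderCones (P : ObjectProperty C) : Prop :=
  ∀ A B X : C, ExistsTriangle A B X → P A → P B → P X

def ClosedUnderCocones (P : ObjectProperty C) : Prop :=
  ∀ A B X : C, ExistsTriangle A B X → P B → P X → P A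

structure IsLeftThick (P : ObjectProperty C) : Prop where
  extensions : ClosedUnderExtensions P
  summands : ClosedUnderDirectSummands P
  cocones : ClosedUnderCocones P

structure IsRightThick (P : ObjectProperty C) : Prop where
  extensions : ClosedUnderExtensions P
  summands : ClosedUnderDirectSummands P
  cones : ClosedUnderCones P

structure IsThick (P : ObjectProperty C) : Prop where
  left : IsLeftThick P
  right : IsRightThick P

/-- The smallest thick subcategory containing `P`. -/
def Thick (P : ObjectProperty C) : ObjectProperty C :=
  fun M => ∀ T : ObjectProperty C, IsThick T → P ≤ T → T M

/-! ### Finite resolutions and coresolutions -/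

/-- `M` admits a finite `P`-resolution `0 ⟶ X_n ⟶ ⋯ ⟶ X_0 ⟶ M ⟶ 0` of length `n`, spliced from
`𝔼`-triangles `Z_{i+1} ⟶ X_i ⟶ Z_i ⇢` with `Z_0 = M` and `Z_n ≅ X_n`. -/
inductive HasResolution (P : ObjectProperty C) : ℕ → C → Prop
  | zero (M X : C) (e : M ≅ X) (hX : P X) : HasResolution P 0 M
  | succ (n : ℕ) (Z X M : C) (hT : ExistsTriangle Z X M) (hX : P X)
      (hZ : HasResolution P n Z) : HasResolution P (n + 1) M

/-- `M` admits a finite `P`-coresolution `0 ⟶ M ⟶ X_0 ⟶ ⋯ ⟶ X_{-n} ⟶ 0` of length `n`. -/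
inductive HasCoresolution (P : ObjectProperty C) : ℕ → C → Prop
  | zero (M X : C) (e : M ≅ X) (hX : P X) : HasCoresolution P 0 M
  | succ (n : ℕ) (M X Z : C) (hT : ExistsTriangle M X Z) (hX : P X)
      (hZ : HasCoresolution P n Z) : HasCoresolution P (n + 1) M

/-- The class `P^∧_n` of objects with `P`-resolution dimension at most `n`. -/
def resLE (P : ObjectProperty C) (n : ℕ) : ObjectProperty C :=
  fun M => ∃ m ≤ n, HasResolution P m M

/-- The class `P^∧` of objects with finite `P`-resolution dimension. -/
def resFinite (P : ObjectProperty C) : ObjectProperty C :=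
  fun M => ∃ n, resLE P n M

/-- The class `P^∨_n` of objects with `P`-coresolution dimension at most `n`. -/
def coresLE (P : ObjectProperty C) (n : ℕ) : ObjectProperty C :=
  fun M => ∃ m ≤ n, HasCoresolution P m M

/-! ### Relative generators and cogenerators -/

def IsRelativeCogenerator (W P : ObjectProperty C) : Prop :=
  W ≤ P ∧ ∀ X, P X → ∃ V X' : C, W V ∧ P X' ∧ ExistsTriangle X V X'

def IsRelativeGenerator (W P : ObjectProperty C) : Prop :=
  W ≤ P ∧ ∀ X, P X → ∃ X' V : C, P X' ∧ W V ∧ ExistsTriangle X' V X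

/-! ### Higher extension groups -/

def IsEProjective (P : C) : Prop :=
  ∀ {A B X : C} (x : A ⟶ B) (y : B ⟶ X), IsConflation x y → ∀ f : P ⟶ X, ∃ g : P ⟶ B, g ≫ y = f

def IsEInjective (I : C) : Prop :=
  ∀ {A B X : C} (x : A ⟶ B) (y : B ⟶ X), IsConflation x y → ∀ f : A ⟶ I, ∃ g : B ⟶ I, x ≫ g = f

variable (C)

/-- `C` has enough `𝔼`-projectives and enough `𝔼`-injectives. -/
structure HasEnough : Prop where
  proj : ∀ X : C, ∃ K P : C, IsEProjective P ∧ ExistsTriangle K P X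
  inj : ∀ X : C, ∃ I L : C, IsEInjective I ∧ ExistsTriangle X I L

/-- The extriangulated category `C` is abelian: the underlying additive category is abelian, and
the conflations are precisely the short exact sequences. (The maps of a short exact sequence being
mono and epi, this forces `𝔼` to be the functor `Ext¹`, via `δ ↦ 𝔰(δ)`.) -/
structure IsAbelianCase : Prop where
  kernels : HasKernels C
  cokernels : HasCokernels C
  normalMono : IsNormalMonoCategory C
  normalEpi : IsNormalEpiCategory C
  conflation_iff : ∀ {A B X : C} (x : A ⟶ B) (y : B ⟶ X),
    IsConflation x y ↔ ∃ h : x ≫ y = 0, (ShortComplex.mk x y h).ShortExact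

/-- The extriangulated category `C` is triangulated: a triangulated structure on the underlying
additive category, with a natural identification `𝔼(X, A) ≅ C(X, A[1])` under which `𝔼`-triangles
are precisely the distinguished triangles. -/
structure TriangulatedCase where
  shift : HasShift C ℤ
  shift_additive : ∀ n : ℤ, (shiftFunctor C n).Additive
  pretriangulated : Pretriangulated C
  triangulated : IsTriangulated C
  iso : ∀ X A : C, Ext1 X A ≃+ (X ⟶ (shiftFunctor C (1 : ℤ)).obj A)
  iso_push : ∀ {X A A' : C} (a : A ⟶ A') (δ : Ext1 X A),
    iso X A' (push Extriangulated.E a δ) = iso X A δ ≫ (shiftFunctor C (1 : ℤ)).map a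
  iso_pull : ∀ {X X' A : C} (c : X' ⟶ X) (δ : Ext1 X A),
    iso X' A (pull Extriangulated.E c δ) = c ≫ iso X A δ
  realizes_iff : ∀ {X A B : C} (δ : Ext1 X A) (x : A ⟶ B) (y : B ⟶ X),
    Realizes δ x y ↔ Pretriangulated.Triangle.mk x y (iso X A δ) ∈ Pretriangulated.distinguishedTriangles

/-- `C` is an extriangulated category with higher extension groups: it is abelian, or triangulated,
or it has enough `𝔼`-projectives and `𝔼`-injectives. -/
inductive HigherExtensions
  | abelian (h : IsAbelianCase C)
  | triangulated (T : TriangulatedCase C)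
  | enough (h : HasEnough C)

variable {C}

abbrev IsAbelianCase.toAbelian (h : IsAbelianCase C) : Abelian C :=
  haveI := h.kernels
  haveI := h.cokernels
  haveI := h.normalMono
  haveI := h.normalEpi
  haveI : HasTerminal C := HasZeroObject.hasTerminal
  haveI := hasFiniteProducts_of_has_binary_and_terminal (C := C)
  { }

/-- A chosen syzygy `ΩX`, sitting in an `𝔼`-triangle `ΩX ⟶ P ⟶ X ⇢` with `P` projective. -/
noncomputable def HasEnough.syzygy (h : HasEnough C) (X : C) : C := (h.proj X).choose

/-- The iterated syzygies `Ω^k X`. -/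
noncomputable def HasEnough.syzygyPow (h : HasEnough C) : ℕ → C → C
  | 0, X => X
  | k + 1, X => h.syzygy (h.syzygyPow k X)

/-- The higher extension groups `𝔼^k(X, Y)`: the groups `Ext^k(X, Y)` in the abelian case,
`C(X, Y[k])` in the triangulated case, and `𝔼^{k+1}(X, Y) = 𝔼(Ω^k X, Y)` if there are enough
projectives and injectives. Only `k ≥ 1` is used; in the last case `𝔼^0` is set to be `C(X, Y)`. -/
noncomputable def higherExt (h : HigherExtensions.{w} C) (k : ℕ) (X Y : C) :
    AddCommGrpCat.{max u v w} :=
  match h with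
  | .abelian h =>
      letI := h.toAbelian
      haveI := HasExt.standard C
      AddCommGrpCat.of (ULift.{w} (Abelian.Ext.{max u v} X Y k))
  | .triangulated T =>
      letI := T.shift
      AddCommGrpCat.of (ULift.{max u w} (X ⟶ (shiftFunctor C (k : ℤ)).obj Y))
  | .enough h =>
      match k with
      | 0 => AddCommGrpCat.of (ULift.{max u w} (X ⟶ Y))
      | k + 1 => AddCommGrpCat.of (ULift.{max u v} (Ext1 (h.syzygyPow k X) Y))

/-- `𝔼^k(P, Q) = 0`. -/
def ExtVanishes (h : HigherExtensions.{w} C) (k : ℕ) (P Q : ObjectProperty C) : Prop :=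
  ∀ X Y : C, P X → Q Y → Subsingleton (higherExt h k X Y)

/-! ### Relative homological dimensions -/

/-- `pd_P(M) = min {m ≥ 0 : 𝔼^{≥ m+1}(M, P) = 0}`, with value `⊤` if there is no such `m`. -/
noncomputable def relPd (h : HigherExtensions.{w} C) (P : ObjectProperty C) (M : C) : ℕ∞ :=
  ⨅ (m : ℕ) (_ : ∀ j ≥ m + 1, ExtVanishes h j (fun X => X = M) P), (m : ℕ∞)

/-- `id_P(M) = min {m ≥ 0 : 𝔼^{≥ m+1}(P, M) = 0}`, with value `⊤` if there is no such `m`. -/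
noncomputable def relId (h : HigherExtensions.{w} C) (P : ObjectProperty C) (M : C) : ℕ∞ :=
  ⨅ (m : ℕ) (_ : ∀ j ≥ m + 1, ExtVanishes h j P (fun Y => Y = M)), (m : ℕ∞)

/-- `pd_P(Q) = sup {pd_P(M) : M ∈ Q}`. -/
noncomputable def pdim (h : HigherExtensions.{w} C) (P Q : ObjectProperty C) : ℕ∞ :=
  ⨆ (M : C) (_ : Q M), relPd h P M

/-- `id_P(Q) = sup {id_P(M) : M ∈ Q}`. -/
noncomputable def idim (h : HigherExtensions.{w} C) (P Q : ObjectProperty C) : ℕ∞ :=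
  ⨆ (M : C) (_ : Q M), relId h P M

/-! ### Frobenius pairs, AB contexts and cotorsion pairs -/

/-- `(X, W)` is a left Frobenius pair in `C`. -/
structure IsLeftFrobeniusPair (h : HigherExtensions.{w} C) (X W : ObjectProperty C) : Prop where
  leftThick : IsLeftThick X
  summands : ClosedUnderDirectSummands W
  injective : idim h X W = 0
  cogenerator : IsRelativeCogenerator W X

/-- `(X, W)` is a left Frobenius pair cut on `S`. -/
structure IsLeftFrobeniusPairCut (h : HigherExtensions.{w} C) (S X W : ObjectProperty C) :
    Prop where
  leftThick : IsLeftThick X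
  frobenius : IsLeftFrobeniusPair h (X ⊓ S) (W ⊓ S)
  projective : pdim h W (W ⊓ S) = 0
  generator : IsRelativeGenerator (W ⊓ S) W
  extensions : ClosedUnderExtensions W
  summands : ClosedUnderDirectSummands W

/-- `(A, B)` is a left weak AB context cut on `S`. -/
structure IsLeftWeakABContextCut (h : HigherExtensions.{w} C) (S A B : ObjectProperty C) :
    Prop where
  frobenius : IsLeftFrobeniusPairCut h S A (A ⊓ B)
  rightThick : IsRightThick (B ⊓ S)
  le_res : B ⊓ S ≤ resFinite (A ⊓ S)

/-- `(A, B)` is a left `n`-cotorsion pair cut on `S` (for `n ≥ 1`). -/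
structure IsLeftCotorsionPairCut (h : HigherExtensions.{w} C) (n : ℕ)
    (S A B : ObjectProperty C) : Prop where
  summands : ClosedUnderDirectSummands A
  vanishing : ∀ i, 1 ≤ i → i ≤ n → ExtVanishes h i (A ⊓ S) B
  complete : ∀ M, S M → ∃ K X : C, A X ∧ resLE B (n - 1) K ∧ ExistsTriangle K X M

/-- `(A, B)` is a right `n`-cotorsion pair cut on `S` (for `n ≥ 1`). -/
structure IsRightCotorsionPairCut (h : HigherExtensions.{w} C) (n : ℕ)
    (S A B : ObjectProperty C) : Prop where
  summands : ClosedUnderDirectSummands B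
  vanishing : ∀ i, 1 ≤ i → i ≤ n → ExtVanishes h i A (B ⊓ S)
  complete : ∀ M, S M → ∃ Y L : C, B Y ∧ coresLE A (n - 1) L ∧ ExistsTriangle M Y L

/-- `(A, B)` is an `n`-cotorsion pair cut on `S` (for `n ≥ 1`). -/
structure IsCotorsionPairCut (h : HigherExtensions.{w} C) (n : ℕ)
    (S A B : ObjectProperty C) : Prop where
  left : IsLeftCotorsionPairCut h n S A B
  right : IsRightCotorsionPairCut h n S A B

end

end Extri

/-! Write `X = A ⊓ S` and `W = A ⊓ B ⊓ S`. The argument is Auslander–Buchweitz approximation for the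
left Frobenius pair `(X, W)`. Induction on the length of a resolution, using pushouts of conflations
and the octahedron, gives every `M` in `X^∧` two conflations `K ⟶ X₀ ⟶ M` and `M ⟶ H ⟶ X'` with `K,
H` in `W^∧` and `X₀, X'` in `X` (`HasResolution.exists_precover`,
`HasResolution.exists_preenvelope`).

Everything rests on `W^∧ = B ⊓ S`. A class closed under cones and containing `W` contains `W^∧`.
Conversely, for `M` in `B ⊓ S` the conflation `K ⟶ X₀ ⟶ M` has both ends in `B ⊓ S`, so `X₀` lies in
`W` and `M` in `W^∧`. Dimension shifting then carries `𝔼^j(X, W) = 0` to `𝔼^j(X, B ⊓ S) = 0`, and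
the two approximations become those of the cotorsion pair.

For thickness of `X^∧` (`isThick_resFinite`), `𝔼(X, W^∧) = 0` splits the pushouts that occur, and
`W^∧ = B ⊓ S` is closed under extensions. A thick class containing `X` is closed under cones, hence
contains `X^∧`. -/

open scoped ZeroObject

namespace Extri

/-! ### Functoriality of extensions -/

section Calculus

variable {C : Type u} [Category.{v} C] (E : Cᵒᵖ ⥤ C ⥤ AddCommGrpCat.{w})

lemma push_id {X A : C} (δ : Extension E X A) : push E (𝟙 A) δ = δ := by
  simp [push]

lemma pull_id {X A : C} (δ : Extension E X A) : pull E (𝟙 X) δ = δ := by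
  simp [pull]

lemma push_push {X A A' A'' : C} (a : A ⟶ A') (a' : A' ⟶ A'') (δ : Extension E X A) :
    push E a' (push E a δ) = push E (a ≫ a') δ := by
  simp [push]

lemma pull_pull {X X' X'' A : C} (c : X' ⟶ X) (c' : X'' ⟶ X') (δ : Extension E X A) :
    pull E c' (pull E c δ) = pull E (c' ≫ c) δ := by
  simp [pull]

lemma push_pull {X X' A A' : C} (a : A ⟶ A') (c : X' ⟶ X) (δ : Extension E X A) :
    push E a (pull E c δ) = pull E c (push E a δ) := by
  simp [push, pull]

lemma push_add {X A A' : C} (a : A ⟶ A') (δ δ' : Extension E X A) :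
    push E a (δ + δ') = push E a δ + push E a δ' :=
  map_add _ _ _

lemma pull_add {X X' A : C} (c : X' ⟶ X) (δ δ' : Extension E X A) :
    pull E c (δ + δ') = pull E c δ + pull E c δ' :=
  map_add _ _ _

lemma push_zero {X A A' : C} (a : A ⟶ A') : push E a (0 : Extension E X A) = 0 :=
  map_zero _

lemma zero_push [Preadditive C] [∀ X : Cᵒᵖ, (E.obj X).Additive] {X A A' : C} (δ : Extension E X A) :
    push E (0 : A ⟶ A') δ = 0 := by
  simp [push]

lemma zero_pull [Preadditive C] [E.Additive] {X X' A : C} (δ : Extension E X A) :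
    pull E (0 : X' ⟶ X) δ = 0 := by
  simp [pull]

end Calculus

/-! ### Isomorphisms and zero objects in summand-closed classes -/

section Summands

variable {C : Type u} [Category.{v} C] [Preadditive C] [HasZeroObject C] [HasBinaryBiproducts C]
  {X : ObjectProperty C}

/-- The isomorphism `A ⊞ 0 ≅ A`. -/
noncomputable def biprodZero (A : C) : A ⊞ (0 : C) ≅ A where
  hom := biprod.fst
  inv := biprod.inl
  hom_inv_id := by
    exact biprod.hom_ext' _ _ (by simp) ((isZero_zero C).eq_of_src _ _)

lemma ClosedUnderDirectSummands.of_iso (h : ClosedUnderDirectSummands X) {M N : C} (e : M ≅ N)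
    (hN : X N) : X M :=
  h M 0 N ⟨e.symm ≪≫ (biprodZero M).symm⟩ hN

lemma ClosedUnderDirectSummands.zero (h : ClosedUnderDirectSummands X) {M : C} (hM : X M) :
    X (0 : C) :=
  h 0 M M ⟨(biprodZero M).symm ≪≫ biprod.braiding M 0⟩ hM

end Summands

attribute [instance] Extriangulated.additive_left Extriangulated.additive_right

variable {C : Type u} [Category.{v} C] [Preadditive C] [HasZeroObject C] [HasBinaryBiproducts C]
  [Extriangulated.{w} C]

/-! ### Conflations: isomorphism invariance, octahedra, pullbacks and pushouts -/

section Conflations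

lemma exists_realizes {X A : C} (δ : Ext1 X A) :
    ∃ (B : C) (x : A ⟶ B) (y : B ⟶ X), Realizes δ x y := by
  obtain ⟨⟨B, x, y⟩, h⟩ := Quotient.exists_rep (Extriangulated.s δ)
  exact ⟨B, x, y, h.symm⟩

lemma Realizes.exists_iso {X A B B' : C} {δ : Ext1 X A} {x : A ⟶ B} {y : B ⟶ X}
    {x' : A ⟶ B'} {y' : B' ⟶ X} (h : Realizes δ x y) (h' : Realizes δ x' y') :
    ∃ b : B ≅ B', x ≫ b.hom = x' ∧ b.hom ≫ y' = y := by
  have := Quotient.exact (h.symm.trans h')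
  exact this

lemma Realizes.of_iso_mid {X A B B' : C} {δ : Ext1 X A} {x : A ⟶ B} {y : B ⟶ X}
    (h : Realizes δ x y) (b : B ≅ B') : Realizes δ (x ≫ b.hom) (b.inv ≫ y) :=
  Eq.trans h (Quotient.sound ⟨b, rfl, by simp⟩)

lemma realizes_inl_snd (A X : C) :
    Realizes (0 : Ext1 X A) (biprod.inl : A ⟶ A ⊞ X) (biprod.snd : A ⊞ X ⟶ X) :=
  Extriangulated.realizes_zero X A

lemma realizes_inr_fst (A X : C) :
    Realizes (0 : Ext1 A X) (biprod.inr : X ⟶ A ⊞ X) (biprod.fst : A ⊞ X ⟶ A) := by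
  convert (realizes_inl_snd X A).of_iso_mid (biprod.braiding X A) using 1
  · ext <;> simp
  · simp

/-- The shear automorphism `(x, y) ↦ (x, x + y)` of `X ⊞ X`. -/
noncomputable def shear (X : C) : X ⊞ X ≅ X ⊞ X where
  hom := biprod.desc (biprod.lift (𝟙 X) (𝟙 X)) biprod.inr
  inv := biprod.desc (biprod.lift (𝟙 X) (-𝟙 X)) biprod.inr
  hom_inv_id := by ext <;> simp
  inv_hom_id := by ext <;> simp

/-- The shear carries `biprod.inl` to the diagonal. Having the diagonal as an inflation lets (ET4)ᵒᵖ
pull a direct sum of extensions back along it, which produces common pullbacks. -/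
lemma exists_realizes_diag (X : C) :
    ∃ q : X ⊞ X ⟶ X, Realizes (0 : Ext1 X X) (biprod.lift (𝟙 X) (𝟙 X)) q :=
  ⟨_, by simpa [shear] using (realizes_inl_snd X X).of_iso_mid (shear X)⟩

lemma exists_realizes_codiag (X : C) :
    ∃ i : X ⟶ X ⊞ X, Realizes (0 : Ext1 X X) i (biprod.desc (𝟙 X) (𝟙 X)) := by
  refine ⟨biprod.inl ≫ (shear X).symm.hom, ?_⟩
  convert (realizes_inl_snd X X).of_iso_mid (shear X).symm using 1
  ext <;> simp [shear]

/-- Comparing a conflation with this trivial one through (ET3) or its dual yields pieces of the long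
exact sequences. -/
lemma realizes_zero_left (X : C) : Realizes (0 : Ext1 X (0 : C)) (0 : 0 ⟶ X) (𝟙 X) := by
  let e : (0 : C) ⊞ X ≅ X :=
    { hom := biprod.snd, inv := biprod.inr, hom_inv_id := by
        refine biprod.hom_ext' _ _ ((isZero_zero C).eq_of_src _ _) (by simp) }
  simpa [e] using (realizes_inl_snd (0 : C) X).of_iso_mid e

/-- A morphism killed by an inflation factors through the corresponding deflation. -/
lemma Realizes.exists_desc {X A B D : C} {δ : Ext1 X A} {x : A ⟶ B} {y : B ⟶ X}
    (h : Realizes δ x y) (f : B ⟶ D) (hf : x ≫ f = 0) : ∃ g : X ⟶ D, y ≫ g = f := by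
  obtain ⟨c, hc, -⟩ := Extriangulated.et3 h (realizes_zero_left D) 0 f (by simp [hf])
  exact ⟨c, by simpa using hc⟩

/-- A morphism to the end of a conflation along which the extension pulls back to zero lifts. -/
lemma Realizes.exists_lift {X A B D : C} {δ : Ext1 X A} {x : A ⟶ B} {y : B ⟶ X}
    (h : Realizes δ x y) (f : D ⟶ X) (hf : pull Extriangulated.E f δ = 0) :
    ∃ g : D ⟶ B, g ≫ y = f := by
  obtain ⟨b, -, hb⟩ := Extriangulated.realization (realizes_inl_snd A D) h (𝟙 A) f
    (by rw [hf, push_zero])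
  exact ⟨biprod.inr ≫ b, by rw [Category.assoc, ← hb]; simp⟩

/-- The extension of a conflation pulls back to zero along maps factoring through its deflation. -/
lemma Realizes.pull_eq_zero {X A B D : C} {δ : Ext1 X A} {x : A ⟶ B} {y : B ⟶ X}
    (h : Realizes δ x y) (g : D ⟶ B) : pull Extriangulated.E (g ≫ y) δ = 0 := by
  obtain ⟨a, -, ha⟩ := Extriangulated.et3_op (realizes_zero_left D) h g (g ≫ y) (by simp)
  rw [← ha, push_zero]

/-- The difference `f - 𝟙 B` kills `x`, so it factors through `y`; it is also killed by `y`. Hence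
it squares to zero, and `2 - f` inverts `f`. -/
lemma Realizes.isIso_endo {X A B : C} {δ : Ext1 X A} {x : A ⟶ B} {y : B ⟶ X}
    (h : Realizes δ x y) (f : B ⟶ B) (hx : x ≫ f = x) (hy : f ≫ y = y) : IsIso f := by
  obtain ⟨g, hg⟩ := h.exists_desc (f - 𝟙 B) (by simp [hx])
  have h0 : (f - 𝟙 B) ≫ (f - 𝟙 B) = 0 := by
    nth_rw 2 [← hg]
    rw [← Category.assoc, Preadditive.sub_comp, hy]
    simp
  simp only [Preadditive.comp_sub, Preadditive.sub_comp, Category.comp_id, Category.id_comp] at h0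
  have h1 : f ≫ f = f + f - 𝟙 B := by
    rw [← sub_eq_zero, ← h0]; abel
  exact ⟨𝟙 B + 𝟙 B - f, by simp [h1], by simp [h1]⟩

/-- `𝔼`-triangles are stable under isomorphisms of their ends. -/
lemma Realizes.of_iso_ends {X A B X' A' : C} {δ : Ext1 X A} {x : A ⟶ B} {y : B ⟶ X}
    (h : Realizes δ x y) (a : A ≅ A') (c : X ≅ X') :
    Realizes (push Extriangulated.E a.hom (pull Extriangulated.E c.inv δ))
      (a.inv ≫ x) (y ≫ c.hom) := by
  obtain ⟨B', x', y', h'⟩ :=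
    exists_realizes (push Extriangulated.E a.hom (pull Extriangulated.E c.inv δ))
  obtain ⟨b, hb, hb'⟩ := Extriangulated.realization h h' a.hom c.hom
    (by rw [← push_pull, pull_pull]; simp [pull_id])
  obtain ⟨b₁, hb₁, hb₁'⟩ := Extriangulated.realization h' h a.inv c.inv
    (by rw [push_push]; simp [push_id])
  -- The map `b₁` need not invert `b`, but both composites fix the inflation and the deflation, so
  -- both are isomorphisms.
  have i₁ : IsIso (b ≫ b₁) := h.isIso_endo _ (by rw [reassoc_of% hb, hb₁]; simp)
    (by rw [Category.assoc, ← hb₁', ← reassoc_of% hb']; simp)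
  have i₂ : IsIso (b₁ ≫ b) := h'.isIso_endo _ (by rw [reassoc_of% hb₁, hb]; simp)
    (by rw [Category.assoc, ← hb', ← reassoc_of% hb₁']; simp)
  have : IsSplitMono b := ⟨⟨b₁ ≫ inv (b ≫ b₁), by rw [← Category.assoc]; simp⟩⟩
  have : Epi b := epi_of_epi b₁ b
  have : IsIso b := isIso_of_epi_of_isSplitMono b
  have := h'.of_iso_mid (asIso b).symm
  convert this using 1
  · rw [Iso.symm_hom, asIso_inv, IsIso.eq_comp_inv, Category.assoc, hb, Iso.inv_hom_id_assoc]
  · simp [hb']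

lemma ExistsTriangle.of_iso {A B X A' B' X' : C} (h : ExistsTriangle A B X) (a : A ≅ A')
    (b : B ≅ B') (c : X ≅ X') : ExistsTriangle A' B' X' := by
  obtain ⟨x, y, δ, h⟩ := h
  exact ⟨_, _, _, (h.of_iso_ends a c).of_iso_mid b⟩

lemma existsTriangle_biprod (A X : C) : ExistsTriangle A (A ⊞ X) X :=
  ⟨_, _, _, realizes_inl_snd A X⟩

lemma existsTriangle_zero_left (X : C) : ExistsTriangle (0 : C) X X :=
  ⟨_, _, _, realizes_zero_left X⟩

lemma ExistsTriangle.biprod {A B X A' B' X' : C} (h : ExistsTriangle A B X)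
    (h' : ExistsTriangle A' B' X') : ExistsTriangle (A ⊞ A') (B ⊞ B') (X ⊞ X') := by
  obtain ⟨x, y, δ, h⟩ := h
  obtain ⟨x', y', δ', h'⟩ := h'
  exact ⟨_, _, _, Extriangulated.realizes_directSum h h'⟩

lemma ExistsTriangle.nonempty_iso_biprod {A B X : C} (h : ExistsTriangle A B X)
    (hE : Subsingleton (Ext1 X A)) : Nonempty (B ≅ A ⊞ X) := by
  obtain ⟨x, y, δ, h⟩ := h
  rw [Subsingleton.elim δ 0] at h
  obtain ⟨b, -⟩ := h.exists_iso (realizes_inl_snd A X)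
  exact ⟨b⟩

/-- The octahedron on two composable inflations. -/
lemma ExistsTriangle.exists_comp_inflations {A B D M F : C} (h : ExistsTriangle A B D)
    (h' : ExistsTriangle B M F) : ∃ N, ExistsTriangle A M N ∧ ExistsTriangle D N F := by
  obtain ⟨x, y, δ, h⟩ := h
  obtain ⟨x', y', δ', h'⟩ := h'
  obtain ⟨N, d, e, i, p, δ'', -, -, -, h₁, h₂, -⟩ := Extriangulated.et4 h h'
  exact ⟨N, ⟨_, _, _, h₁⟩, ⟨_, _, _, h₂⟩⟩

/-- The octahedron on two composable deflations. -/
lemma ExistsTriangle.exists_comp_deflations {D A B F M : C} (h : ExistsTriangle D A B)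
    (h' : ExistsTriangle F B M) : ∃ N, ExistsTriangle N A M ∧ ExistsTriangle D N F := by
  obtain ⟨x, y, δ, h⟩ := h
  obtain ⟨x', y', δ', h'⟩ := h'
  obtain ⟨N, d, e, i, p, δ'', -, -, -, h₁, h₂, -⟩ := Extriangulated.et4_op h h'
  exact ⟨N, ⟨_, _, _, h₁⟩, ⟨_, _, _, h₂⟩⟩

/-- Two conflations with the same right end have a common pullback. -/
lemma ExistsTriangle.exists_pullback {A₁ B₁ A₂ B₂ X : C} (h₁ : ExistsTriangle A₁ B₁ X)
    (h₂ : ExistsTriangle A₂ B₂ X) :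
    ∃ N, ExistsTriangle A₁ N B₂ ∧ ExistsTriangle A₂ N B₁ := by
  obtain ⟨x₁, y₁, δ₁, h₁⟩ := h₁
  obtain ⟨x₂, y₂, δ₂, h₂⟩ := h₂
  -- The object `N` is the middle term of `(δ₁ ⊕ δ₂)` pulled back along the diagonal, an extension
  -- of `X` by `A₁ ⊞ A₂`. Dividing out one summand `Aᵢ` leaves the other conflation.
  obtain ⟨q, hq⟩ := exists_realizes_diag X
  obtain ⟨N, d, e, -, -, -, -, -, -, -, hN, -⟩ :=
    Extriangulated.et4_op (Extriangulated.realizes_directSum h₁ h₂) hq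
  refine ⟨N, ?_, ?_⟩
  · obtain ⟨N', d', e', i, p, δ'', -, -, -, h, h', -⟩ :=
      Extriangulated.et4 (realizes_inl_snd A₁ A₂) hN
    have : push Extriangulated.E (biprod.snd : A₁ ⊞ A₂ ⟶ A₂)
        (pull Extriangulated.E (biprod.lift (𝟙 X) (𝟙 X)) (directSum Extriangulated.E δ₁ δ₂))
        = δ₂ := by
      simp [directSum, push_add, pull_add, push_push, pull_pull, push_pull, push_id, pull_id,
        zero_push]
    rw [this] at h'
    obtain ⟨b, -⟩ := Realizes.exists_iso h' h₂
    exact ExistsTriangle.of_iso ⟨_, _, _, h⟩ (Iso.refl _) (Iso.refl _) b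
  · obtain ⟨N', d', e', i, p, δ'', -, -, -, h, h', -⟩ :=
      Extriangulated.et4 (realizes_inr_fst A₁ A₂) hN
    have : push Extriangulated.E (biprod.fst : A₁ ⊞ A₂ ⟶ A₁)
        (pull Extriangulated.E (biprod.lift (𝟙 X) (𝟙 X)) (directSum Extriangulated.E δ₁ δ₂))
        = δ₁ := by
      simp [directSum, push_add, pull_add, push_push, pull_pull, push_pull, push_id, pull_id,
        zero_push]
    rw [this] at h'
    obtain ⟨b, -⟩ := Realizes.exists_iso h' h₁
    exact ExistsTriangle.of_iso ⟨_, _, _, h⟩ (Iso.refl _) (Iso.refl _) b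

/-- Two conflations with the same left end have a common pushout. -/
lemma ExistsTriangle.exists_pushout {Z B₁ X₁ B₂ X₂ : C} (h₁ : ExistsTriangle Z B₁ X₁)
    (h₂ : ExistsTriangle Z B₂ X₂) :
    ∃ N, ExistsTriangle B₁ N X₂ ∧ ExistsTriangle B₂ N X₁ := by
  obtain ⟨x₁, y₁, δ₁, h₁⟩ := h₁
  obtain ⟨x₂, y₂, δ₂, h₂⟩ := h₂
  -- Dually, `N` realizes `δ₁ ⊕ δ₂` pushed out along the codiagonal, and restricting to one summand
  -- `Xᵢ` recovers `Bᵢ` as a subobject.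
  obtain ⟨q, hq⟩ := exists_realizes_codiag Z
  obtain ⟨N, d, e, -, -, -, -, -, -, -, hN, -⟩ :=
    Extriangulated.et4 hq (Extriangulated.realizes_directSum h₁ h₂)
  refine ⟨N, ?_, ?_⟩
  · obtain ⟨N', d', e', i, p, δ'', -, -, -, h, h', -⟩ :=
      Extriangulated.et4_op hN (realizes_inl_snd X₁ X₂)
    have : pull Extriangulated.E (biprod.inl : X₁ ⟶ X₁ ⊞ X₂)
        (push Extriangulated.E (biprod.desc (𝟙 Z) (𝟙 Z)) (directSum Extriangulated.E δ₁ δ₂))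
        = δ₁ := by
      simp [directSum, push_add, pull_add, push_push, pull_pull, push_pull, push_id, pull_id,
        zero_pull]
    rw [this] at h'
    obtain ⟨b, -⟩ := Realizes.exists_iso h' h₁
    exact ExistsTriangle.of_iso ⟨_, _, _, h⟩ b (Iso.refl _) (Iso.refl _)
  · obtain ⟨N', d', e', i, p, δ'', -, -, -, h, h', -⟩ :=
      Extriangulated.et4_op hN (realizes_inr_fst X₁ X₂)
    have : pull Extriangulated.E (biprod.inr : X₂ ⟶ X₁ ⊞ X₂)
        (push Extriangulated.E (biprod.desc (𝟙 Z) (𝟙 Z)) (directSum Extriangulated.E δ₁ δ₂))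
        = δ₂ := by
      simp [directSum, push_add, pull_add, push_push, pull_pull, push_pull, push_id, pull_id,
        zero_pull]
    rw [this] at h'
    obtain ⟨b, -⟩ := Realizes.exists_iso h' h₂
    exact ExistsTriangle.of_iso ⟨_, _, _, h⟩ b (Iso.refl _) (Iso.refl _)

end Conflations

/-! ### Vanishing of higher extensions in the three cases -/

section HigherExtensions

lemma subsingleton_of_ulift (α : Type*) (h : Subsingleton (ULift α)) : Subsingleton α :=
  Equiv.ulift.symm.subsingleton

lemma ext1_eq_zero_of_lift {X A B : C} {δ : Ext1 X A} {x : A ⟶ B} {y : B ⟶ X}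
    (h : Realizes δ x y) (g : X ⟶ B) (hg : g ≫ y = 𝟙 X) : δ = 0 := by
  have := h.pull_eq_zero g
  rwa [hg, pull_id] at this

lemma IsEProjective.subsingleton_ext1 {P : C} (hP : IsEProjective P) (A : C) :
    Subsingleton (Ext1 P A) := by
  refine subsingleton_of_forall_eq 0 fun δ => ?_
  obtain ⟨B, x, y, h⟩ := exists_realizes δ
  obtain ⟨g, hg⟩ := hP x y ⟨δ, h⟩ (𝟙 P)
  exact ext1_eq_zero_of_lift h g hg

/-- Dimension shifting along `K ⟶ P ⟶ Q` with `P` projective. -/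
lemma subsingleton_ext1_of_syzygy {K P Q A B X : C} (hP : IsEProjective P)
    (hT : ExistsTriangle K P Q) (h : ExistsTriangle A B X)
    (hB : Subsingleton (Ext1 Q B)) (hA : Subsingleton (Ext1 K A)) :
    Subsingleton (Ext1 Q X) := by
  refine subsingleton_of_forall_eq 0 fun δ => ?_
  obtain ⟨i, p, ε, hε⟩ := hT
  obtain ⟨x, y, η, hη⟩ := h
  obtain ⟨D, r, s, hδ⟩ := exists_realizes δ
  obtain ⟨p', hp'⟩ := hP r s ⟨δ, hδ⟩ p
  -- Projectivity of `P` exhibits `δ` as the pushout of `ε` along `a : K ⟶ X`. Since `𝔼(K, A) = 0`,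
  -- `a` lifts to `B`, so `δ` comes from `𝔼(Q, B) = 0`.
  obtain ⟨a, -, ha⟩ := Extriangulated.et3_op hε hδ p' (𝟙 Q) (by simp [hp'])
  obtain ⟨g, hg⟩ := hη.exists_lift a (Subsingleton.elim _ _)
  rw [pull_id] at ha
  rw [← ha, ← hg, ← push_push, Subsingleton.elim (push _ g ε) 0, push_zero]

/-- Only the conflations are tied to short exact sequences, so `δ = 0` is detected by splitting: the
obstruction to lifting `𝟙 X` lies in the vanishing group `Ext¹(X, A)`. -/
lemma IsAbelianCase.subsingleton_ext1 (h : IsAbelianCase C) {X A : C}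
    (hE : Subsingleton (higherExt (.abelian h) 1 X A)) : Subsingleton (Ext1 X A) := by
  let := h.toAbelian
  have := HasExt.standard C
  have hE' : Subsingleton (Abelian.Ext.{max u v} X A 1) :=
    subsingleton_of_ulift (Abelian.Ext.{max u v} X A 1) hE
  refine subsingleton_of_forall_eq 0 fun δ => ?_
  obtain ⟨B, x, y, hδ⟩ := exists_realizes δ
  obtain ⟨h0, hS⟩ := (h.conflation_iff x y).1 ⟨δ, hδ⟩
  obtain ⟨g, hg⟩ := Abelian.Ext.covariant_sequence_exact₃ X hS (Abelian.Ext.mk₀ (𝟙 X)) (zero_add 1)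
    (hE'.elim _ _)
  obtain ⟨g, rfl⟩ := (Abelian.Ext.mk₀_bijective _ _).2 g
  rw [Abelian.Ext.mk₀_comp_mk₀] at hg
  exact ext1_eq_zero_of_lift hδ g ((Abelian.Ext.mk₀_bijective _ _).1 hg)

lemma IsAbelianCase.subsingleton_higherExt (h : IsAbelianCase C) {P A B X : C} (j : ℕ)
    (hT : ExistsTriangle A B X)
    (hB : Subsingleton (higherExt (.abelian h) j P B))
    (hA : Subsingleton (higherExt (.abelian h) (j + 1) P A)) :
    Subsingleton (higherExt (.abelian h) j P X) := by
  let := h.toAbelian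
  have := HasExt.standard C
  have hB' : Subsingleton (Abelian.Ext.{max u v} P B j) :=
    subsingleton_of_ulift (Abelian.Ext.{max u v} P B j) hB
  have hA' : Subsingleton (Abelian.Ext.{max u v} P A (j + 1)) :=
    subsingleton_of_ulift (Abelian.Ext.{max u v} P A (j + 1)) hA
  obtain ⟨x, y, hxy⟩ := hT
  obtain ⟨h0, hS⟩ := (h.conflation_iff x y).1 hxy
  suffices Subsingleton (Abelian.Ext.{max u v} P X j) from
    (Equiv.ulift (α := Abelian.Ext.{max u v} P X j)).subsingleton
  refine subsingleton_of_forall_eq 0 fun e => ?_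
  obtain ⟨g, hg⟩ := Abelian.Ext.covariant_sequence_exact₃ P hS e rfl (hA'.elim _ _)
  rw [← hg, hB'.elim g 0, Abelian.Ext.zero_comp]

lemma TriangulatedCase.subsingleton_ext1 (T : TriangulatedCase C) {X A : C}
    (hE : Subsingleton (higherExt (.triangulated T) 1 X A)) : Subsingleton (Ext1 X A) := by
  let := T.shift
  have : Subsingleton (X ⟶ (shiftFunctor C (1 : ℤ)).obj A) :=
    subsingleton_of_ulift (X ⟶ (shiftFunctor C ((1 : ℕ) : ℤ)).obj A) hE
  exact (T.iso X A).toEquiv.subsingleton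

lemma TriangulatedCase.subsingleton_higherExt (T : TriangulatedCase C) {P A B X : C} (j : ℕ)
    (hT : ExistsTriangle A B X)
    (hB : Subsingleton (higherExt (.triangulated T) j P B))
    (hA : Subsingleton (higherExt (.triangulated T) (j + 1) P A)) :
    Subsingleton (higherExt (.triangulated T) j P X) := by
  let := T.shift
  have := T.shift_additive
  let := T.pretriangulated
  have hB' : Subsingleton (P ⟶ (shiftFunctor C (j : ℤ)).obj B) :=
    subsingleton_of_ulift (P ⟶ (shiftFunctor C (j : ℤ)).obj B) hB
  have hA' : Subsingleton (P ⟶ (shiftFunctor C ((j + 1 : ℕ) : ℤ)).obj A) :=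
    subsingleton_of_ulift (P ⟶ (shiftFunctor C ((j + 1 : ℕ) : ℤ)).obj A) hA
  obtain ⟨x, y, δ, hδ⟩ := hT
  have hD := Pretriangulated.Triangle.shift_distinguished _ ((T.realizes_iff δ x y).1 hδ) (j : ℤ)
  -- The connecting map of the triangle shifted by `j` ends in `A[j][1]`, which is identified with
  -- `A[j + 1]`.
  have hA'' : Subsingleton (P ⟶ (shiftFunctor C (1 : ℤ)).obj ((shiftFunctor C (j : ℤ)).obj A)) :=
    (((shiftFunctorAdd' C (j : ℤ) 1 ((j + 1 : ℕ) : ℤ) (by simp)).app A).homToEquiv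
      (Z := P)).symm.subsingleton
  suffices Subsingleton (P ⟶ (shiftFunctor C (j : ℤ)).obj X) from
    (Equiv.ulift (α := P ⟶ (shiftFunctor C (j : ℤ)).obj X)).subsingleton
  refine subsingleton_of_forall_eq 0 fun e => ?_
  obtain ⟨g, hg⟩ := Pretriangulated.Triangle.coyoneda_exact₃ _ hD e (hA''.elim _ _)
  rw [hg, hB'.elim g 0]
  exact zero_comp

variable (h : HigherExtensions.{w} C)

lemma subsingleton_ext1_of_higherExt {X A : C} (hE : Subsingleton (higherExt h 1 X A)) :
    Subsingleton (Ext1 X A) := by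
  cases h with
  | abelian h => exact h.subsingleton_ext1 hE
  | triangulated T => exact T.subsingleton_ext1 hE
  | enough h => exact subsingleton_of_ulift (Ext1 X A) hE

/-- The vanishing of `𝔼^j(P, X)` that the long exact sequence of an `𝔼`-triangle
`A ⟶ B ⟶ X ⇢` provides. -/
lemma subsingleton_higherExt {P A B X : C} (j : ℕ) (hj : 1 ≤ j)
    (hT : ExistsTriangle A B X) (hB : Subsingleton (higherExt h j P B))
    (hA : Subsingleton (higherExt h (j + 1) P A)) : Subsingleton (higherExt h j P X) := by
  cases h with
  | abelian h => exact h.subsingleton_higherExt j hT hB hA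
  | triangulated T => exact T.subsingleton_higherExt j hT hB hA
  | enough h =>
    obtain ⟨k, rfl⟩ := Nat.exists_eq_add_of_le' hj
    have hB' : Subsingleton (Ext1 (h.syzygyPow k P) B) :=
      subsingleton_of_ulift (Ext1 (h.syzygyPow k P) B) hB
    have hA' : Subsingleton (Ext1 (h.syzygyPow (k + 1) P) A) :=
      subsingleton_of_ulift (Ext1 (h.syzygyPow (k + 1) P) A) hA
    obtain ⟨Q, hQ, hQT⟩ := (h.proj (h.syzygyPow k P)).choose_spec
    have := subsingleton_ext1_of_syzygy hQ hQT hT hB' hA'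
    exact (Equiv.ulift (α := Ext1 (h.syzygyPow k P) X)).subsingleton

lemma idim_eq_zero_iff (P Q : ObjectProperty C) :
    idim h P Q = 0 ↔ ∀ j, 1 ≤ j → ExtVanishes h j P Q := by
  have key : ∀ M, relId h P M = 0 ↔ ∀ j, 1 ≤ j → ExtVanishes h j P (fun Y => Y = M) := by
    intro M
    refine ⟨fun h0 => ?_, fun h0 => ?_⟩
    · have h1 : relId h P M < 1 := by simp [h0]
      simp only [relId, iInf_lt_iff] at h1
      obtain ⟨m, hm, hm1⟩ := h1
      obtain rfl : m = 0 := by simpa using hm1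
      simpa using hm
    · exact le_antisymm (iInf₂_le (0 : ℕ) (by simpa using h0)) bot_le
  simp only [idim, ENat.iSup_eq_zero, key]
  exact ⟨fun H j hj X Y hX hY => H Y hY j hj X Y hX rfl,
    fun H M hM j hj X Y hX hY => H j hj X Y hX (hY ▸ hM)⟩

/-- Dimension shifting: degree `j` for `M` needs degree `j + 1` for the kernel `Z`, so the induction
treats all degrees at once. -/
lemma ExtVanishes.resolution {P W : ObjectProperty C} (H : ∀ j, 1 ≤ j → ExtVanishes h j P W)
    {n : ℕ} {X : C} (hX : HasResolution W n X)
    (hW : ∀ X Y : C, Nonempty (X ≅ Y) → W Y → W X) :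
    ∀ j, 1 ≤ j → ∀ Q, P Q → Subsingleton (higherExt h j Q X) := by
  induction hX with
  | zero M X e hX => exact fun j hj Q hQ => H j hj Q M hQ (hW _ _ ⟨e⟩ hX)
  | succ n Z X M hT hX hZ ih =>
    exact fun j hj Q hQ => subsingleton_higherExt h j hj hT (H j hj Q X hQ hX)
      (ih (j + 1) (by omega) Q hQ)

end HigherExtensions

/-! ### Auslander–Buchweitz approximations and thickness of `X^∧` -/

section AuslanderBuchweitz

variable {X W Y : ObjectProperty C}

lemma ClosedUnderExtensions.biprod (h : ClosedUnderExtensions X) {M N : C} (hM : X M)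
    (hN : X N) : X (M ⊞ N) :=
  h _ _ _ (existsTriangle_biprod M N) hM hN

lemma HasResolution.of_iso {n : ℕ} {M N : C} (h : HasResolution X n M) (e : M ≅ N) :
    HasResolution X n N := by
  cases h with
  | zero _ X₀ e' hX => exact .zero _ _ (e.symm ≪≫ e') hX
  | succ n Z X₀ _ hT hX hZ => exact .succ _ _ _ _ (hT.of_iso (.refl _) (.refl _) e) hX hZ

lemma HasResolution.mono (hWX : W ≤ X) {n : ℕ} {M : C} (h : HasResolution W n M) :
    HasResolution X n M := by
  induction h with
  | zero M X₀ e hX => exact .zero _ _ e (hWX _ hX)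
  | succ n Z X₀ M hT hX _ ih => exact .succ _ _ _ _ hT (hWX _ hX) ih

lemma HasResolution.of_closedUnderCones (hs : ClosedUnderDirectSummands Y)
    (hc : ClosedUnderCones Y) (hXY : X ≤ Y) {n : ℕ} {M : C} (h : HasResolution X n M) : Y M := by
  induction h with
  | zero M X₀ e hX => exact hs.of_iso e (hXY _ hX)
  | succ n Z X₀ M hT hX _ ih => exact hc _ _ _ hT ih (hXY _ hX)

lemma HasResolution.biprod (hX : ClosedUnderExtensions X) {n : ℕ} {M N : C}
    (h : HasResolution X n M) (hN : X N) : HasResolution X n (M ⊞ N) := by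
  cases h with
  | zero _ X₀ e hX₀ => exact .zero _ _ (biprod.mapIso e (.refl N)) (hX.biprod hX₀ hN)
  | succ n Z X₀ _ hT hX₀ hZ =>
    exact .succ _ _ _ _ (hT.biprod (existsTriangle_zero_left N)) (hX.biprod hX₀ hN)
      (hZ.of_iso (biprodZero Z).symm)

lemma HasResolution.mem_resFinite {n : ℕ} {M : C} (h : HasResolution X n M) : resFinite X M :=
  ⟨n, n, le_rfl, h⟩

lemma resFinite_iff {M : C} : resFinite X M ↔ ∃ n, HasResolution X n M :=
  ⟨fun ⟨_, m, _, h⟩ => ⟨m, h⟩, fun ⟨_, h⟩ => h.mem_resFinite⟩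

lemma resFinite_of_mem {M : C} (h : X M) : resFinite X M :=
  (HasResolution.zero M M (.refl M) h).mem_resFinite

/-- If `P` has an `X`-resolution of length `n` and `M ⟶ P ⟶ X' ⇢` is an `𝔼`-triangle with `X'` in `X`,
then `M` has an `X`-resolution of length `n`. -/
lemma HasResolution.cocone (hX : IsLeftThick X) {n : ℕ} {M P X' : C}
    (h : HasResolution X n P) (hX' : X X') (hT : ExistsTriangle M P X') :
    HasResolution X n M := by
  cases h with
  | zero _ X₀ e hX₀ =>
    exact .zero _ _ (.refl M) (hX.cocones _ _ _ hT (hX.summands.of_iso e hX₀) hX')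
  | succ n Z X₀ _ hP hX₀ hZ =>
    -- The kernel `N` of `X₀ ⟶ P ⟶ X'` lies in `X` and covers `M` with the same kernel `Z`, so the
    -- length is unchanged.
    obtain ⟨N, hN, hN'⟩ := hP.exists_comp_deflations hT
    exact .succ _ _ _ _ hN' (hX.cocones _ _ _ hN hX₀ hX') hZ

/-- Every object of `X^∧` embeds into an object of `W^∧` with cokernel in `X`. -/
lemma HasResolution.exists_preenvelope (hX : IsLeftThick X) (hWX : IsRelativeCogenerator W X)
    {n : ℕ} {M : C} (h : HasResolution X n M) :
    ∃ H X', HasResolution W n H ∧ X X' ∧ ExistsTriangle M H X' := by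
  induction h with
  | zero M X₀ e hX₀ =>
    obtain ⟨V, X', hV, hX', hT⟩ := hWX.2 M (hX.summands.of_iso e hX₀)
    exact ⟨V, X', .zero _ _ (.refl V) hV, hX', hT⟩
  | succ n Z X₀ M hT hX₀ _ ih =>
    obtain ⟨H, X', hH, hX', hT'⟩ := ih
    obtain ⟨N, hN, hN'⟩ := hT.exists_pushout hT'
    -- Embedding the pushout `N` in `V` from `W` gives conflations `H ⟶ V ⟶ L` and `M ⟶ L ⟶ X''`:
    -- the first resolves `L` by `W`, the second is the required embedding.
    obtain ⟨V, X'', hV, hX'', hT''⟩ := hWX.2 N (hX.extensions _ _ _ hN hX₀ hX')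
    obtain ⟨L, hL, hL'⟩ := hN'.exists_comp_inflations hT''
    exact ⟨L, X'', .succ _ _ _ _ hL hV hH, hX'', hL'⟩

/-- Every object of `X^∧` is the cokernel of an object of `W^∧` in an object of `X`. -/
lemma HasResolution.exists_precover (hX : IsLeftThick X) (hW : ClosedUnderDirectSummands W)
    (hWX : IsRelativeCogenerator W X) {n : ℕ} {M : C} (h : HasResolution X n M) :
    ∃ K X₀, resFinite W K ∧ X X₀ ∧ ExistsTriangle K X₀ M := by
  cases h with
  | zero _ X₀ e hX₀ =>
    have hM := hX.summands.of_iso e hX₀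
    -- Only used to know that `W` is nonempty, hence contains the zero object.
    obtain ⟨V, -, hV, -, -⟩ := hWX.2 M hM
    exact ⟨0, M, resFinite_of_mem (hW.zero hV), hM, existsTriangle_zero_left M⟩
  | succ n Z X₀ _ hT hX₀ hZ =>
    obtain ⟨H, X', hH, hX', hT'⟩ := hZ.exists_preenvelope hX hWX
    obtain ⟨N, hN, hN'⟩ := hT.exists_pushout hT'
    exact ⟨H, N, hH.mem_resFinite, hX.extensions _ _ _ hN hX₀ hX', hN'⟩

/-- Pushing out along `M ⟶ H` with `H` in `W^∧` splits the conflation, so `N` is a cocone of a map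
from `H ⊞ X₀` to an object of `X`. -/
lemma HasResolution.extension (hX : IsLeftThick X) (hWX : IsRelativeCogenerator W X)
    (hE : ∀ P Q, X P → resFinite W Q → Subsingleton (Ext1 P Q)) {n : ℕ} {M N X₀ : C}
    (h : HasResolution X n M) (hX₀ : X X₀) (hT : ExistsTriangle M N X₀) :
    HasResolution X n N := by
  obtain ⟨H, X', hH, hX', hT'⟩ := h.exists_preenvelope hX hWX
  obtain ⟨P, hP, hP'⟩ := hT.exists_pushout hT'
  obtain ⟨e⟩ := hP'.nonempty_iso_biprod (hE _ _ hX₀ hH.mem_resFinite)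
  exact (((hH.mono hWX.1).biprod hX.extensions hX₀).of_iso e.symm).cocone hX hX' hP

/-- One object `X₀` covers both summands, with kernels `K₁` and `K₂`. Comparing the covers `X₀` and
`X₀ ⊞ X₀` of `M ⊞ M'` shows that `K₁ ⊞ K₂` has a resolution one step shorter, and induction applies
to `K₁`. -/
lemma HasResolution.summand (hX : IsLeftThick X) (hWX : IsRelativeCogenerator W X)
    (hE : ∀ P Q, X P → resFinite W Q → Subsingleton (Ext1 P Q)) {n : ℕ} {M M' : C}
    (h : HasResolution X n (M ⊞ M')) : HasResolution X n M := by
  induction n generalizing M M' with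
  | zero =>
    cases h with
    | zero _ X₀ e hX₀ => exact .zero _ _ (.refl M) (hX.summands _ _ _ ⟨e.symm⟩ hX₀)
  | succ n ih =>
    cases h with
    | succ _ Z X₀ _ hT hX₀ hZ =>
      obtain ⟨K₁, hK₁, -⟩ := hT.exists_comp_deflations ⟨_, _, _, realizes_inr_fst M M'⟩
      obtain ⟨K₂, hK₂, -⟩ := hT.exists_comp_deflations (existsTriangle_biprod M M')
      obtain ⟨P, hP, hP'⟩ := hT.exists_pullback (hK₁.biprod hK₂)
      have hPn := hZ.extension hX hWX hE (hX.extensions.biprod hX₀ hX₀) hP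
      exact .succ _ _ _ _ hK₁ hX₀ (ih (hPn.cocone hX hX₀ hP'))

/-- For a left Frobenius pair `(X, W)` such that `W^∧` is closed under extensions, the class `X^∧`
is thick. -/
lemma isThick_resFinite (hX : IsLeftThick X) (hW : ClosedUnderDirectSummands W)
    (hWX : IsRelativeCogenerator W X)
    (hE : ∀ P Q, X P → resFinite W Q → Subsingleton (Ext1 P Q))
    (hWe : ClosedUnderExtensions (resFinite W)) : IsThick (resFinite X) := by
  have summands : ClosedUnderDirectSummands (resFinite X) := by
    rintro M M' N ⟨e⟩ hN
    obtain ⟨n, hN⟩ := resFinite_iff.1 hN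
    exact ((hN.of_iso e).summand hX hWX hE).mem_resFinite
  -- The kernel `N` of the composite `X₀ ⟶ B ⟶ M` is an extension of `A` by some `K` in `W^∧`, so a
  -- cone lies in `X^∧` once such extensions do. This is stated with `H` open because closure under
  -- extensions is proved from it, with `A` in `W^∧`, before closure under cones.
  have cone_of_res {A B M : C} (hT : ExistsTriangle A B M) (hB : resFinite X B)
      (H : ∀ K N, resFinite W K → ExistsTriangle K N A → resFinite X N) : resFinite X M := by
    obtain ⟨n, hB⟩ := resFinite_iff.1 hB
    obtain ⟨K, X₀, hK, hX₀, hT'⟩ := hB.exists_precover hX hW hWX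
    obtain ⟨N, hN, hN'⟩ := hT'.exists_comp_deflations hT
    obtain ⟨m, hm⟩ := resFinite_iff.1 (H K N hK hN')
    exact (HasResolution.succ _ _ _ _ hN hX₀ hm).mem_resFinite
  have extensions : ClosedUnderExtensions (resFinite X) := by
    intro A B M hT hA hM
    obtain ⟨n, hA⟩ := resFinite_iff.1 hA
    obtain ⟨m, hM⟩ := resFinite_iff.1 hM
    obtain ⟨K, X₀, hK, hX₀, hT'⟩ := hM.exists_precover hX hW hWX
    obtain ⟨P, hP, hP'⟩ := hT.exists_pullback hT'
    -- The middle term is the cone of `K ⟶ P` with `K` in `W^∧`, so the extensions that remain stay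
    -- within `W^∧`.
    refine cone_of_res hP' (hA.extension hX hWX hE hX₀ hP).mem_resFinite fun K' N hK' hN => ?_
    obtain ⟨l, hl⟩ := resFinite_iff.1 (hWe _ _ _ hN hK' hK)
    exact (hl.mono hWX.1).mem_resFinite
  have cones : ClosedUnderCones (resFinite X) := by
    intro A B M hT hA hB
    refine cone_of_res hT hB fun K N hK hN => extensions _ _ _ hN ?_ hA
    obtain ⟨l, hl⟩ := resFinite_iff.1 hK
    exact (hl.mono hWX.1).mem_resFinite
  have cocones : ClosedUnderCocones (resFinite X) := by
    intro A B M hT hB hM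
    obtain ⟨m, hM⟩ := resFinite_iff.1 hM
    obtain ⟨K, X₀, hK, hX₀, hT'⟩ := hM.exists_precover hX hW hWX
    obtain ⟨P, hP, hP'⟩ := hT.exists_pullback hT'
    obtain ⟨l, hl⟩ := resFinite_iff.1 hK
    obtain ⟨k, hk⟩ := resFinite_iff.1 (extensions _ _ _ hP' (hl.mono hWX.1).mem_resFinite hB)
    exact (hk.cocone hX hX₀ hP).mem_resFinite
  exact ⟨⟨extensions, summands, cocones⟩, ⟨extensions, summands, cones⟩⟩

lemma thick_eq_resFinite (h : IsThick (resFinite X)) : Thick X = resFinite X := by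
  ext M
  refine ⟨fun hM => hM _ h fun _ => resFinite_of_mem, fun hM T hT hXT => ?_⟩
  obtain ⟨n, hM⟩ := resFinite_iff.1 hM
  exact hM.of_closedUnderCones hT.right.summands hT.right.cones hXT

end AuslanderBuchweitz

end Extri

/-! ### The proposition -/

theorem proposition5p1 {C : Type u} [Category.{v} C] [Preadditive C] [HasZeroObject C]
    [HasBinaryBiproducts C] [Extri.Extriangulated.{w} C] (h : Extri.HigherExtensions.{w} C)
    (S A B ω : ObjectProperty C) (hω : ω = A ⊓ B)
    (hAB : Extri.IsLeftWeakABContextCut h S A B) :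
    (Extri.resFinite (ω ⊓ S) = B ⊓ S ∧
      Extri.idim h (A ⊓ S) (B ⊓ S) = 0 ∧
      Extri.Thick (A ⊓ S) = Extri.resFinite (A ⊓ S)) ∧
    Extri.IsCotorsionPairCut h 1 (Extri.Thick (A ⊓ S)) (A ⊓ S) (B ⊓ S) := by
  subst hω
  obtain ⟨hX, hW, hid, hWX⟩ := hAB.frobenius.frobenius
  have hY := hAB.rightThick
  have hvan := (Extri.idim_eq_zero_iff h _ _).1 hid
  have hres : Extri.resFinite (A ⊓ B ⊓ S) = B ⊓ S := by
    ext M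
    refine ⟨fun hM => ?_, fun hM => ?_⟩
    · obtain ⟨n, hM⟩ := Extri.resFinite_iff.1 hM
      exact hM.of_closedUnderCones hY.summands hY.cones fun _ hN => ⟨hN.1.2, hN.2⟩
    · obtain ⟨n, hMn⟩ := Extri.resFinite_iff.1 (hAB.le_res _ hM)
      obtain ⟨K, X₀, hK, hX₀, hT⟩ := hMn.exists_precover hX hW hWX
      obtain ⟨m, hm⟩ := Extri.resFinite_iff.1 hK
      have hKY := hm.of_closedUnderCones hY.summands hY.cones fun _ hN => ⟨hN.1.2, hN.2⟩
      -- Both ends lie in `B ⊓ S`, so the cover `X₀` lies in `A ⊓ B ⊓ S` and prolongs the resolution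
      -- of `K` to one of `M`.
      have hX₀Y := hY.extensions _ _ _ hT hKY hM
      exact (Extri.HasResolution.succ _ _ _ _ hT ⟨⟨hX₀.1, hX₀Y.1⟩, hX₀.2⟩ hm).mem_resFinite
  have hvanY : ∀ j, 1 ≤ j → Extri.ExtVanishes h j (A ⊓ S) (B ⊓ S) := by
    intro j hj P Q hP hQ
    rw [← hres] at hQ
    obtain ⟨n, hQ⟩ := Extri.resFinite_iff.1 hQ
    exact Extri.ExtVanishes.resolution h hvan hQ (fun _ _ ⟨e⟩ => hW.of_iso e) j hj P hP
  have hthick : Extri.IsThick (Extri.resFinite (A ⊓ S)) := by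
    refine Extri.isThick_resFinite hX hW hWX (fun P Q hP hQ => ?_) ?_
    · rw [hres] at hQ
      exact Extri.subsingleton_ext1_of_higherExt h (hvanY 1 le_rfl P Q hP hQ)
    · rw [hres]
      exact hY.extensions
  have hT := Extri.thick_eq_resFinite hthick
  refine ⟨⟨hres, (Extri.idim_eq_zero_iff h _ _).2 hvanY, hT⟩, ⟨hX.summands, ?_, ?_⟩,
    ⟨hY.summands, ?_, ?_⟩⟩
  · exact fun i hi _ P Q hP hQ => hvanY i hi P Q hP.1 hQ
  · intro M hM
    rw [hT] at hM
    obtain ⟨n, hM⟩ := Extri.resFinite_iff.1 hM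
    obtain ⟨K, X₀, hK, hX₀, hT'⟩ := hM.exists_precover hX hW hWX
    rw [hres] at hK
    -- For `n = 1` the allowed resolution length `n - 1` is `0`, so membership of `K` in `B ⊓ S`
    -- suffices.
    exact ⟨K, X₀, hX₀, ⟨0, le_rfl, .zero _ _ (Iso.refl K) hK⟩, hT'⟩
  · exact fun i hi _ P Q hP hQ => hvanY i hi P Q hP hQ.1
  · intro M hM
    rw [hT] at hM
    obtain ⟨n, hM⟩ := Extri.resFinite_iff.1 hM
    obtain ⟨H, X', hH, hX', hT'⟩ := hM.exists_preenvelope hX hWX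
    have hHY := hH.mem_resFinite
    rw [hres] at hHY
    exact ⟨H, X', hHY, ⟨0, le_rfl, .zero _ _ (Iso.refl X') hX'⟩, hT'⟩
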